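/- **Setting.** Let $X_j$ ($j$ in a finite index set) be nonempty finite chains with $m_j$ elements, written $X_j=\{0,1,\dots,m_j-1\}$, and let $\mathcal X=\prod_j X_j$ with the componentwise order. A finite set $V$ of agents is given. Agent $i$ knows a function $J_i:\mathcal X\to\mathbb R$ that is submodular, i.e. $J_i(x\vee y)+J_i(x\wedge y)\le J_i(x)+J_i(y)$ for all $x,y$. Put $J=\sum_{i\in V}J_i$. Let $\Omega(\mathcal X)$ be the set of all $\rho=(\rho_j(l))_{j,\,1\le l\le m_j-1}$ with entries in $[0,1]$ such that $\rho_j(l+1)\le\rho_j(l)$; it carries the Euclidean norm. With $\rho_j(0):=1$, define $\theta_\rho(t)\in\mathcal X$ for $t\in[0,1]$ by $\theta_\rho(t)_j=\max\{l:\rho_j(l)\ge t\}$. *Greedy algorithm.* For $\rho\in\Omega(\mathcal X)$, list all $r=\sum_j(m_j-1)$ entries in decreasing order $\rho_{j_1}(l_1)\ge\dots\ge\rho_{j_r}(l_r)$, where ties are broken arbitrarily except that for each $j$ the entries $\rho_j(1),\rho_j(2),\dots$ appear in this order. Put $y_0=(0,\dots,0)$ and $y_s=y_{s-1}+e_{j_s}$.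 For $f:\mathcal X\to\mathbb R$ put $f^{\mathrm{ext}}(\rho)=f(y_0)+\sum_{s=1}^r\rho_{j_s}(l_s)\,(f(y_s)-f(y_{s-1}))$, which does not depend on how ties are broken. The greedy subgradient $\partial f^{\mathrm{ext}}|_\rho$ (for the chosen order) is the vector whose $(j_s,l_s)$ entry is $f(y_s)-f(y_{s-1})$. *Network.* Let $G$ be a directed graph on $V$ with closed neighborhoods $N(i)=\{i\}\cup\{w:(i,w)\text{ is an edge}\}$, and let $(c_{iw})$ be a matrix of nonnegative weights with $c_{iw}=0$ for $w\notin N(i)$. Assume that 1. $G$ is strongly connected; 2. there is $\eta\in(0,1)$ with $c_{ii}\ge\eta$ for all $i$; 3. $c_{iw}\ge\eta$ for every edge $(i,w)$; 4. the matrix $(c_{iw})$ is doubly stochastic. *Distributed method.* Given step sizes $\gamma_k>0$, agent $i$ starts from some $\rho^i[0]\in\Omega(\mathcal X)$ and, for $k\ge1$, uses only $J_i$ and the estimates of the agents in $N(i)$ to compute $$\nu^i=\sum_{w\in N(i)}c_{iw}\,\rho^w[k-1],\qquad \rho^i[k]=\mathbb P_{\Omega(\mathcal X)}\bigl(\nu^i-\gamma_k\,\partial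 J_i^{\mathrm{ext}}|_{\nu^i}\bigr),$$ where $\mathbb P_{\Omega(\mathcal X)}$ is the Euclidean projection and the greedy subgradient may be computed with any tie-breaking, chosen anew by every agent at every step. **Theorem.** Under these assumptions the following hold. (a) The relaxation is convex and exact: all $J_i^{\mathrm{ext}}$ and $J^{\mathrm{ext}}$ are convex on $\Omega(\mathcal X)$, $J^{\mathrm{ext}}=\sum_iJ_i^{\mathrm{ext}}$ there, $\min_{\mathcal X}J=\min_{\Omega(\mathcal X)}J^{\mathrm{ext}}$ (both minima being attained), and $\rho\in\Omega(\mathcal X)$ minimizes $J^{\mathrm{ext}}$ over $\Omega(\mathcal X)$ if and only if $\theta_\rho(t)$ minimizes $J$ over $\mathcal X$ for all $t\in(0,1]$, and also for $t=0$ in case no entry of $\rho$ is $0$. (b) The distributed method minimizes $J$ exactly. Let $\gamma_k>0$, $\sum_k\gamma_k=\infty$ and $\sum_k\gamma_k^2<\infty$. From all initial estimates in $\Omega(\mathcal X)$ the method can be run, and for each run there is a minimizer $\rho^*$ of $J^{\mathrm{ext}}$ over $\Omega(\mathcal X)$ such that $\rho^i[k]\to\rho^*$ as $k\to\infty$ for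 all agents $i$. The point $\theta_{\rho^*}(t)$ minimizes $J$ for all $t\in(0,1]$, and also for $t=0$ in case no entry of $\rho^*$ is $0$. Moreover, for each $t\in[0,1]$ that is not one of the finitely many entries of $\rho^*$, for all sufficiently large $k$ the rounded estimates $\theta_{\rho^i[k]}(t)$ of all agents $i$ equal $\theta_{\rho^*}(t)$, and so they are one and the same minimizer of $J$ over $\mathcal X$. -/

import Mathlib

open Filter Topology

/-! ### Finite products of chains, monotone vectors, and rounding -/

section Lattice

variable {ι : Type*} (X : ι → Type*) [∀ j, LinearOrder (X j)] [∀ j, OrderBot (X j)]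

/-- Coordinates of `ρ`: pairs `(j, x)` with `x` a non-minimal element of the chain `X j`.
If `X j = {0, …, m j - 1}` these are the pairs `(j, 1), …, (j, m j - 1)`. -/
abbrev LevelIndex := Σ j, {x : X j // ⊥ < x}

/-- The Euclidean space containing the vectors `ρ = (ρ_j(x))`; there are
`r = ∑ j, (|X j| - 1)` coordinates. -/
abbrev Estimate := EuclideanSpace ℝ (LevelIndex X)

/-- `Ω(X)`: vectors with entries in `[0, 1]` that are non-increasing along each chain. -/
def Omega : Set (Estimate X) :=
  {ρ | (∀ q, 0 ≤ ρ q ∧ ρ q ≤ 1) ∧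
    ∀ (j : ι) (x y : {x : X j // ⊥ < x}), x ≤ y → ρ ⟨j, y⟩ ≤ ρ ⟨j, x⟩}

variable {X}

/-- Submodularity on a lattice. -/
def IsSubmodular {L : Type*} [Lattice L] (f : L → ℝ) : Prop :=
  ∀ x y, f (x ⊔ y) + f (x ⊓ y) ≤ f x + f y

/-- The rounding map: the `j`-th coordinate of `θ_ρ(t)` is the largest `x` in `X j` with
`ρ_j(x) ≥ t`, where `ρ_j(⊥)` counts as `1` (so it is `⊥` if no `x > ⊥` qualifies). -/
noncomputable def theta [∀ j, Fintype (X j)] (ρ : Estimate X) (t : ℝ) : ∀ j, X j := fun j =>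
  haveI : DecidablePred fun x : {x : X j // ⊥ < x} => t ≤ ρ ⟨j, x⟩ := Classical.decPred _
  (Finset.univ.filter fun x : {x : X j // ⊥ < x} => t ≤ ρ ⟨j, x⟩).sup Subtype.val

end Lattice

/-! ### The greedy algorithm: extension and subgradient -/

section Greedy

variable {ι : Type*} [Fintype ι] [DecidableEq ι] {X : ι → Type*}
  [∀ j, LinearOrder (X j)] [∀ j, OrderBot (X j)] [∀ j, Fintype (X j)]

/-- An enumeration of all the coordinates. -/
abbrev Enumeration (X : ι → Type*) [∀ j, LinearOrder (X j)] [∀ j, OrderBot (X j)]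
    [∀ j, Fintype (X j)] :=
  Fin (Fintype.card (LevelIndex X)) ≃ LevelIndex X

/-- `σ` lists the entries of `ρ` in decreasing order; ties are broken arbitrarily, except that
within each chain the order of the chain is kept. -/
def IsGreedyOrder (ρ : Estimate X) (σ : Enumeration X) : Prop :=
  (∀ a b, a ≤ b → ρ (σ b) ≤ ρ (σ a)) ∧
    ∀ (j : ι) (x y : {x : X j // ⊥ < x}), x < y → σ.symm ⟨j, x⟩ < σ.symm ⟨j, y⟩

/-- The points `y_0, y_1, …` of the greedy algorithm: `y_0` is the bottom element and `y_{s+1}`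
arises from `y_s` by moving up the coordinate listed next to the element listed next (its
successor in the chain, as `σ` keeps the order of the chain). -/
def greedyPoint (σ : Enumeration X) : ℕ → ∀ j, X j
  | 0 => fun _ => ⊥
  | s + 1 =>
    if h : s < Fintype.card (LevelIndex X) then
      Function.update (greedyPoint σ s) (σ ⟨s, h⟩).1 (σ ⟨s, h⟩).2.1
    else greedyPoint σ s

/-- The value the greedy algorithm returns with the order `σ`. -/
def greedyValue (f : (∀ j, X j) → ℝ) (σ : Enumeration X) (ρ : Estimate X) : ℝ :=
  f (fun _ => ⊥) + ∑ s : Fin (Fintype.card (LevelIndex X)),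
    ρ (σ s) * (f (greedyPoint σ (s.val + 1)) - f (greedyPoint σ s.val))

/-- The subgradient the greedy algorithm returns with the order `σ`. -/
def greedySubgradient (f : (∀ j, X j) → ℝ) (σ : Enumeration X) : Estimate X :=
  WithLp.toLp 2 fun q =>
    f (greedyPoint σ ((σ.symm q).val + 1)) - f (greedyPoint σ (σ.symm q).val)

open Classical in
/-- The extension `f^ext` of `f`, computed by the greedy algorithm. On `Omega X` a greedy order
exists and the value does not depend on which one is used (see the two facts below); outside
`Omega X` the value is irrelevant. -/
noncomputable def extension (f : (∀ j, X j) → ℝ) (ρ : Estimate X) : ℝ :=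
  if h : ∃ σ : Enumeration X, IsGreedyOrder ρ σ then greedyValue f h.choose ρ else 0

theorem exists_equiv_strictMono {α β : Type*} [Fintype α] [LinearOrder β] (key : α → β)
    (hinj : Function.Injective key) :
    ∃ σ : Fin (Fintype.card α) ≃ α, StrictMono fun s => key (σ s) := by
  let _ : LinearOrder α := LinearOrder.lift' key hinj
  let e := Fintype.orderIsoFinOfCardEq α rfl
  exact ⟨e.toEquiv, fun a b h => e.strictMono h⟩

set_option linter.unusedSectionVars false in
theorem exists_isGreedyOrder {ρ : Estimate X} (hρ : ρ ∈ Omega X) :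
    ∃ σ : Enumeration X, IsGreedyOrder ρ σ := by
  classical
  let key : LevelIndex X → Lex (ℝ × Lex (ℕ × Fin (Fintype.card (LevelIndex X)))) := fun q =>
    toLex (- ρ q, toLex ((Finset.univ.filter fun z : X q.1 => z < q.2.1).card,
      Fintype.equivFin _ q))
  have hinj : Function.Injective key := by
    intro a b h
    have h' := congrArg (fun z => (ofLex (ofLex z).2).2) h
    exact (Fintype.equivFin (LevelIndex X)).injective h'
  obtain ⟨σ, hσ⟩ := exists_equiv_strictMono key hinj
  refine ⟨σ, ?_, ?_⟩
  · intro a b hab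
    have h1 : key (σ a) ≤ key (σ b) := hσ.monotone hab
    rcases (Prod.Lex.le_iff.1 h1) with h | h
    · have h2 : - ρ (σ a) < - ρ (σ b) := h
      exact (neg_lt_neg_iff.1 h2).le
    · have h2 : - ρ (σ a) = - ρ (σ b) := h.1
      exact (neg_injective h2).ge
  · intro j x y hxy
    rw [← hσ.lt_iff_lt]
    simp only [Equiv.apply_symm_apply]
    rw [Prod.Lex.lt_iff]
    have h0 : ρ ⟨j, y⟩ ≤ ρ ⟨j, x⟩ := hρ.2 j x y hxy.le
    rcases h0.lt_or_eq with h | h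
    · left
      exact neg_lt_neg h
    · right
      refine ⟨congrArg Neg.neg h.symm, ?_⟩
      rw [Prod.Lex.lt_iff]
      left
      apply Finset.card_lt_card
      rw [Finset.ssubset_iff_of_subset]
      · exact ⟨x.1, by simpa using hxy, by simp⟩
      · intro z hz
        simp only [Finset.mem_filter, Finset.mem_univ, true_and] at hz ⊢
        exact hz.trans hxy

/-- The points of the greedy algorithm are level sets: an auxiliary description. -/
theorem le_greedyPoint_iff {σ : Enumeration X}
    (hσ : ∀ (j : ι) (x y : {x : X j // ⊥ < x}), x < y → σ.symm ⟨j, x⟩ < σ.symm ⟨j, y⟩)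
    {s : ℕ} (hs : s ≤ Fintype.card (LevelIndex X)) (j : ι) (x : {x : X j // ⊥ < x}) :
    x.1 ≤ greedyPoint σ s j ↔ (σ.symm ⟨j, x⟩).val < s := by
  induction s with
  | zero => simpa [greedyPoint] using x.2.ne'
  | succ s ih =>
    have hs' : s < Fintype.card (LevelIndex X) := hs
    have ih := ih hs'.le
    rw [greedyPoint, dif_pos hs']
    obtain ⟨⟨i, z⟩, hq⟩ : ∃ q, q = σ ⟨s, hs'⟩ := ⟨_, rfl⟩
    have hz : σ.symm ⟨i, z⟩ = ⟨s, hs'⟩ := by rw [hq]; simp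
    rw [← hq]
    by_cases hj : j = i
    · subst hj
      rw [Function.update_self]
      constructor
      · intro h
        have h1 : x ≤ z := h
        rcases h1.lt_or_eq with h2 | h2
        · have h3 := hσ _ _ _ h2
          rw [hz] at h3
          have h4 : (σ.symm ⟨j, x⟩).val < s := h3
          omega
        · rw [h2, hz]
          exact Nat.lt_succ_self s
      · intro h
        by_contra h1
        have h2 : z < x := not_le.1 h1
        have h3 := hσ _ _ _ h2
        rw [hz] at h3
        have h4 : s < (σ.symm ⟨j, x⟩).val := h3
        omega
    · rw [Function.update_of_ne hj, ih]
      have : (σ.symm ⟨j, x⟩).val ≠ s := by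
        intro h
        have h1 : σ.symm ⟨j, x⟩ = σ.symm ⟨i, z⟩ := by rw [hz]; exact Fin.ext h
        have h2 := σ.symm.injective h1
        exact hj (congrArg Sigma.fst h2)
      omega

set_option linter.unusedSectionVars false in
theorem le_theta_iff {ρ : Estimate X} (hρ : ρ ∈ Omega X) (t : ℝ) (j : ι)
    (x : {x : X j // ⊥ < x}) : x.1 ≤ theta ρ t j ↔ t ≤ ρ ⟨j, x⟩ := by
  classical
  unfold theta
  rw [Finset.le_sup_iff x.2]
  constructor
  · rintro ⟨y, hy, hxy⟩
    simp only [Finset.mem_filter, Finset.mem_univ, true_and] at hy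
    exact hy.trans (hρ.2 j x y hxy)
  · intro h
    exact ⟨x, by simpa using h, le_rfl⟩

/-- Summing the greedy increments over the entries that are at least `t` gives `f (θ_ρ(t))`. -/
theorem apply_theta_eq (f : (∀ j, X j) → ℝ) {ρ : Estimate X} (hρ : ρ ∈ Omega X)
    {σ : Enumeration X} (hσ : IsGreedyOrder ρ σ) (t : ℝ) :
    f (theta ρ t) = f (fun _ => ⊥) + ∑ s : Fin (Fintype.card (LevelIndex X)),
      (if t ≤ ρ (σ s) then f (greedyPoint σ (s.val + 1)) - f (greedyPoint σ s.val) else 0) := by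
  classical
  let r := Fintype.card (LevelIndex X)
  obtain ⟨c, hcr, hc⟩ : ∃ c ≤ r, ∀ s : Fin r, t ≤ ρ (σ s) ↔ s.val < c := by
    by_cases hall : ∀ s : Fin r, t ≤ ρ (σ s)
    · exact ⟨r, le_rfl, fun s => ⟨fun _ => s.2, fun _ => hall s⟩⟩
    · have hex : ∃ n, ∃ h : n < r, ¬ t ≤ ρ (σ ⟨n, h⟩) := by
        obtain ⟨s, hs⟩ := not_forall.1 hall
        exact ⟨s.1, s.2, hs⟩
      obtain ⟨h1, h2⟩ := Nat.find_spec hex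
      refine ⟨Nat.find hex, h1.le, fun s => ⟨fun hs => ?_, fun hs => ?_⟩⟩
      · by_contra hcon
        exact h2 (hs.trans (hσ.1 _ _ (not_lt.1 hcon)))
      · by_contra hcon
        exact Nat.find_min hex hs ⟨s.2, hcon⟩
  have hth : theta ρ t = greedyPoint σ c := by
    funext j
    have key : ∀ x : X j, x ≤ theta ρ t j ↔ x ≤ greedyPoint σ c j := by
      intro x
      rcases (bot_le (a := x)).eq_or_lt with h | h
      · simp [← h]
      · have h1 := le_theta_iff hρ t j ⟨x, h⟩
        have h2 := le_greedyPoint_iff hσ.2 hcr j ⟨x, h⟩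
        have h3 := hc (σ.symm ⟨j, ⟨x, h⟩⟩)
        rw [Equiv.apply_symm_apply] at h3
        exact h1.trans (h3.trans h2.symm)
    exact le_antisymm ((key _).1 le_rfl) ((key _).2 le_rfl)
  have hsum : ∀ d ≤ r, f (greedyPoint σ d) = f (fun _ => ⊥) + ∑ s : Fin r,
      (if s.val < d then f (greedyPoint σ (s.val + 1)) - f (greedyPoint σ s.val) else 0) := by
    intro d hd
    have h1 := Fin.sum_univ_eq_sum_range (fun s =>
      if s < d then f (greedyPoint σ (s + 1)) - f (greedyPoint σ s) else 0) r
    rw [h1, ← Finset.sum_filter]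
    have h2 : (Finset.range r).filter (fun s => s < d) = Finset.range d := by
      ext s
      simp only [Finset.mem_filter, Finset.mem_range]
      omega
    rw [h2, Finset.sum_range_sub (fun s => f (greedyPoint σ s))]
    simp [greedyPoint]
  rw [hth, hsum c hcr]
  congr 1
  exact Finset.sum_congr rfl fun s _ => by simp only [hc s]

/-- On `Omega X`, the value returned by the greedy algorithm is the same for all greedy orders. -/
theorem greedyValue_eq_extension (f : (∀ j, X j) → ℝ) {ρ : Estimate X} (hρ : ρ ∈ Omega X)
    {σ : Enumeration X} (hσ : IsGreedyOrder ρ σ) : greedyValue f σ ρ = extension f ρ := by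
  classical
  have hval : ∀ τ : Enumeration X, IsGreedyOrder ρ τ →
      greedyValue f τ ρ = ∫ t in (0 : ℝ)..1, f (theta ρ t) := by
    intro τ hτ
    have h0 : ∀ q t, (if t ≤ ρ q then (1 : ℝ) else 0) = (Set.Iic (ρ q)).indicator 1 t := by
      intro q t
      simp [Set.indicator_apply]
    have hint : ∀ q, IntervalIntegrable (fun t => if t ≤ ρ q then (1 : ℝ) else 0)
        MeasureTheory.volume 0 1 := by
      intro q
      simp only [h0]
      rw [intervalIntegrable_iff_integrableOn_Ioc_of_le zero_le_one]
      exact (MeasureTheory.integrable_const (1 : ℝ)).indicator measurableSet_Iic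
    have hone : ∀ q, ∫ t in (0 : ℝ)..1, (if t ≤ ρ q then (1 : ℝ) else 0) = ρ q := by
      intro q
      obtain ⟨h1, h2⟩ := hρ.1 q
      simp only [h0]
      rw [intervalIntegral.integral_of_le zero_le_one,
        MeasureTheory.integral_indicator_one measurableSet_Iic]
      rw [MeasureTheory.measureReal_restrict_apply measurableSet_Iic]
      have : Set.Iic (ρ q) ∩ Set.Ioc 0 1 = Set.Ioc 0 (ρ q) := by
        ext t
        simp only [Set.mem_inter_iff, Set.mem_Iic, Set.mem_Ioc]
        constructor
        · rintro ⟨a, b, c⟩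
          exact ⟨b, a⟩
        · rintro ⟨a, b⟩
          exact ⟨b, a, b.trans h2⟩
      rw [this]
      simp [h1]
    have hcongr : ∀ t : ℝ, f (theta ρ t) = f (fun _ => ⊥) +
        ∑ s : Fin (Fintype.card (LevelIndex X)), (if t ≤ ρ (τ s) then (1 : ℝ) else 0) *
          (f (greedyPoint τ (s.val + 1)) - f (greedyPoint τ s.val)) := by
      intro t
      rw [apply_theta_eq f hρ hτ t]
      simp only [ite_mul, one_mul, zero_mul]
    simp only [hcongr]
    rw [intervalIntegral.integral_add (by simp)
      (by
        have := IntervalIntegrable.sum (μ := MeasureTheory.volume) (a := 0) (b := 1) Finset.univ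
          (f := fun s t => (if t ≤ ρ (τ s) then (1 : ℝ) else 0) *
          (f (greedyPoint τ (s.val + 1)) - f (greedyPoint τ s.val)))
          (fun s _ => (hint (τ s)).mul_const _)
        simpa [Finset.sum_fn] using this),
      intervalIntegral.integral_finsetSum (fun s _ => (hint (τ s)).mul_const _)]
    simp only [intervalIntegral.integral_mul_const, hone, greedyValue]
    simp
  have hex : ∃ τ : Enumeration X, IsGreedyOrder ρ τ := ⟨σ, hσ⟩
  rw [extension, dif_pos hex, hval σ hσ, hval _ hex.choose_spec]

end Greedy

/-! ### The distributed projected subgradient method -/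

section Distributed

/-- Every vertex can be reached from every vertex along a directed path. -/
def IsStronglyConnected {V : Type*} (G : Digraph V) : Prop :=
  ∀ i j, Relation.ReflTransGen G.Adj i j

open Classical in
/-- The closed neighborhood `N(i) = {i} ∪ {w : (i, w) is an edge}`. -/
noncomputable def closedNeighborhood {V : Type*} [Fintype V] (G : Digraph V) (i : V) : Finset V :=
  Finset.univ.filter fun w => w = i ∨ G.Adj i w

/-- `z` is the Euclidean projection of `x` onto `S`: a point of `S` nearest to `x`. -/
def IsProjection {E : Type*} [NormedAddCommGroup E] (S : Set E) (x z : E) : Prop :=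
  z ∈ S ∧ ∀ w ∈ S, ‖x - z‖ ≤ ‖x - w‖

variable {V : Type*} [Fintype V] {ι : Type*} [Fintype ι] [DecidableEq ι] {X : ι → Type*}
  [∀ j, LinearOrder (X j)] [∀ j, OrderBot (X j)] [∀ j, Fintype (X j)]

/-- The update one agent performs. It uses only the agent's own cost `f`, the weights `wt` it
gives to the members of its closed neighborhood `N`, their estimates `z`, and the step size `γ`:
it forms the weighted average `ν` of the estimates, runs the greedy algorithm for `f` at `ν`
(with some order `σ`, ties being broken arbitrarily), and projects the subgradient step back
to `Omega X`. The new estimate is `z'`. -/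
def AgentUpdate {N : Finset V} (f : (∀ j, X j) → ℝ) (wt : N → ℝ) (z : N → Estimate X) (γ : ℝ)
    (z' : Estimate X) : Prop :=
  ∃ σ : Enumeration X, IsGreedyOrder (∑ w, wt w • z w) σ ∧
    IsProjection (Omega X) (∑ w, wt w • z w - γ • greedySubgradient f σ) z'

/-- `ρ k i`, the estimate of agent `i` at time `k`, evolves according to the distributed
projected subgradient method on the network `G` with weights `c`, where agent `i` has the
cost `J i` and the step size at time `k ≥ 1` is `γ k`. -/
structure IsRun (G : Digraph V) (c : Matrix V V ℝ) (J : V → (∀ j, X j) → ℝ) (γ : ℕ → ℝ)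
    (ρ : ℕ → V → Estimate X) : Prop where
  init : ∀ i, ρ 0 i ∈ Omega X
  step : ∀ k i, AgentUpdate (N := closedNeighborhood G i) (J i) (fun w => c i w)
    (fun w => ρ k w) (γ (k + 1)) (ρ (k + 1) i)

/-- The global cost `J = ∑ i, J i`. -/
def totalCost (J : V → (∀ j, X j) → ℝ) (x : ∀ j, X j) : ℝ := ∑ i, J i x

end Distributed

/-!
The extension has a probabilistic form: `extension f ρ` is the mean of `f (θ_ρ(t))` over a uniform
threshold `t ∈ [0, 1]` (`extension_eq_integral`). Hence it is bounded below by `min f`, it equals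
`f x` at the vertex that encodes `x`, and it attains `min f` exactly when almost all roundings are
minimizers. As `t ↦ θ_ρ(t)` is locally constant to the left of each `t > 0`, and to the right
of `0` when no entry vanishes, "almost all" becomes "all" (`extension_eq_iff`).

Convexity rests on submodularity. If `y_0 < y_1 < …` is a maximal chain, the increment of `f` at a
step that stays below `x` is at most the increment of `f (x ⊓ y_s)`, and the latter telescope
(`greedy_sum_le_apply`). Integrated over thresholds, this says that each greedy order gives a
linear minorant of the extension, tight where the order is greedy, so the greedy vector is a
subgradient (`extension_add_inner_le`).

For the distributed method, let `V_k = ∑ i, ‖ρ^i[k] - x‖²` for a point `x` of `Ω`. Averaging with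
doubly stochastic weights lowers `V_k` by exactly half of a quadratic `disagreement`, which on a
strongly connected network dominates all squared distances between the agents
(`exists_norm_sub_sq_le_disagreement`). A projected subgradient step changes `V_k` by
at most `-2γ (F_k - F x) + O(γ²)`, where `F` is the sum of the extensions and `F_k` its value at
the estimate of one fixed agent, up to an error of size `γ` times the distances between agents,
since the agents evaluate their costs at different points; half of the gain from averaging absorbs
that error (`sum_norm_sub_sq_le_of_isProjection`). For a minimizer `x` the sequence `V_k` therefore
converges, the disagreement tends to `0`, and `∑ γ_k (F_k - min F) < ∞`. As `∑ γ_k = ∞`, some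
subsequence of the estimates tends to a minimizer `x`; for this `x` the limit of `V_k` is `0`, so
all agents converge to it (`exists_isMinOn_and_tendsto`). A threshold that is not an entry of the
limit separates the entries of the late estimates in the same way as those of the limit.
-/

/-! ### The polytope of relaxed points and its vertices -/

section Relaxation

variable {ι : Type*} [Fintype ι] [DecidableEq ι] {X : ι → Type*}
  [∀ j, LinearOrder (X j)] [∀ j, OrderBot (X j)] [∀ j, Fintype (X j)]

omit [Fintype ι] [DecidableEq ι] [∀ j, Fintype (X j)] in
theorem convex_omega : Convex ℝ (Omega X) := by
  intro ρ hρ π hπ a b ha hb hab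
  have hle : ∀ {x y x' y' : ℝ}, x ≤ y → x' ≤ y' → a * x + b * x' ≤ a * y + b * y' :=
    fun h h' => add_le_add (mul_le_mul_of_nonneg_left h ha) (mul_le_mul_of_nonneg_left h' hb)
  refine ⟨fun q => ⟨?_, ?_⟩, fun j x y hxy => ?_⟩
  · simpa using hle (hρ.1 q).1 (hπ.1 q).1
  · have := hle (hρ.1 q).2 (hπ.1 q).2
    simpa [hab] using this
  · simpa using hle (hρ.2 j x y hxy) (hπ.2 j x y hxy)

omit [Fintype ι] [DecidableEq ι] [∀ j, Fintype (X j)] in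
theorem isCompact_omega : IsCompact (Omega X) := by
  have hcont : ∀ q, Continuous fun ρ : Estimate X => ρ q := fun q => by fun_prop
  have hclosed : IsClosed (Omega X) := by
    simp only [Omega, Set.ofPred_and, Set.ofPred_forall]
    refine IsClosed.inter (isClosed_iInter fun q => ?_)
      (isClosed_iInter fun j => isClosed_iInter fun x => isClosed_iInter fun y =>
        isClosed_iInter fun _ => ?_)
    · exact (isClosed_le continuous_const (hcont q)).inter (isClosed_le (hcont q) continuous_const)
    · exact isClosed_le (hcont _) (hcont _)
  have hbox : IsCompact (WithLp.toLp 2 ''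
      (Set.univ.pi fun _ : LevelIndex X => Set.Icc (0 : ℝ) 1) : Set (Estimate X)) :=
    (isCompact_univ_pi fun _ => isCompact_Icc).image (PiLp.continuous_toLp 2 _)
  exact hbox.of_isClosed_subset hclosed fun ρ hρ =>
    ⟨fun q => ρ q, fun q _ => hρ.1 q, rfl⟩

open Classical in
/-- The vector of `Omega X` that encodes the point `x`: its entry `(j, y)` is `1` if `y ≤ x j`
and `0` otherwise. -/
noncomputable def vertex (x : ∀ j, X j) : Estimate X :=
  WithLp.toLp 2 fun q => if q.2.1 ≤ x q.1 then 1 else 0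

omit [Fintype ι] [DecidableEq ι] [∀ j, Fintype (X j)] in
theorem vertex_mem_omega (x : ∀ j, X j) : vertex x ∈ Omega X := by
  refine ⟨fun q => ?_, fun j y z hyz => ?_⟩
  · simp only [vertex]
    split_ifs <;> norm_num
  · simp only [vertex]
    split_ifs with h1 h2 <;> norm_num
    exact h2 ((show y.1 ≤ z.1 from hyz).trans h1)

theorem theta_vertex (x : ∀ j, X j) {t : ℝ} (ht : t ∈ Set.Ioc (0 : ℝ) 1) :
    theta (vertex x) t = x := by
  classical
  funext j
  refine eq_of_forall_le_iff fun y => ?_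
  rcases (bot_le (a := y)).eq_or_lt with h | h
  · simp [← h]
  · rw [le_theta_iff (vertex_mem_omega x) t j ⟨y, h⟩]
    simp only [vertex]
    split_ifs with hy
    · exact ⟨fun _ => hy, fun _ => ht.2⟩
    · exact ⟨fun h0 => absurd h0 (not_le.2 ht.1), fun h0 => absurd h0 hy⟩

omit [Fintype ι] [DecidableEq ι] in
/-- The rounding only depends on which entries reach the threshold. -/
theorem theta_congr {ρ π : Estimate X} {s t : ℝ} (h : ∀ q, s ≤ ρ q ↔ t ≤ π q) :
    theta ρ s = theta π t := by
  funext j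
  simp only [theta, h]

/-! ### The extension as an integral over thresholds -/

theorem intervalIntegrable_ite_le (a b : ℝ) :
    IntervalIntegrable (fun t => if t ≤ a then b else 0) MeasureTheory.volume 0 1 := by
  have h0 : (fun t => if t ≤ a then b else 0) = (Set.Iic a).indicator fun _ => b := by
    funext t
    simp [Set.indicator_apply]
  rw [h0, intervalIntegrable_iff_integrableOn_Ioc_of_le zero_le_one]
  exact (MeasureTheory.integrable_const b).indicator measurableSet_Iic

theorem integral_ite_le {a : ℝ} (h0 : 0 ≤ a) (h1 : a ≤ 1) (b : ℝ) :
    ∫ t in (0 : ℝ)..1, (if t ≤ a then b else 0) = a * b := by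
  have h : (fun t => if t ≤ a then b else 0) = (Set.Iic a).indicator fun _ => b := by
    funext t
    simp [Set.indicator_apply]
  rw [h, intervalIntegral.integral_of_le zero_le_one,
    MeasureTheory.integral_indicator measurableSet_Iic,
    MeasureTheory.Measure.restrict_restrict measurableSet_Iic]
  have : Set.Iic a ∩ Set.Ioc 0 1 = Set.Ioc 0 a := by
    ext t
    simp only [Set.mem_inter_iff, Set.mem_Iic, Set.mem_Ioc]
    exact ⟨fun h => ⟨h.2.1, h.1⟩, fun h => ⟨h.2, h.1, h.2.trans h1⟩⟩
  rw [this]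
  simp [h0]

omit [DecidableEq ι] in
theorem intervalIntegrable_const_add_sum_ite (ρ : Estimate X) (σ : Enumeration X) (a : ℝ)
    (d : Fin (Fintype.card (LevelIndex X)) → ℝ) :
    IntervalIntegrable (fun t => a + ∑ s, if t ≤ ρ (σ s) then d s else 0)
      MeasureTheory.volume 0 1 := by
  refine IntervalIntegrable.add (by simp) ?_
  have := IntervalIntegrable.sum (μ := MeasureTheory.volume) (a := 0) (b := 1) Finset.univ
    (f := fun s t => if t ≤ ρ (σ s) then d s else 0)
    (fun s _ => intervalIntegrable_ite_le (ρ (σ s)) (d s))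
  simpa [Finset.sum_fn] using this

/-- The value of the greedy formula for an order `σ` that need not be greedy for `ρ`, as an
integral over thresholds. -/
theorem greedyValue_eq_integral (f : (∀ j, X j) → ℝ) (σ : Enumeration X) {ρ : Estimate X}
    (hρ : ρ ∈ Omega X) :
    greedyValue f σ ρ = ∫ t in (0 : ℝ)..1, (f (fun _ => ⊥) +
      ∑ s : Fin (Fintype.card (LevelIndex X)),
        if t ≤ ρ (σ s) then f (greedyPoint σ (s.val + 1)) - f (greedyPoint σ s.val) else 0) := by
  rw [intervalIntegral.integral_add (by simp)
    (by simpa using intervalIntegrable_const_add_sum_ite ρ σ 0 _),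
    intervalIntegral.integral_finsetSum (fun s _ => intervalIntegrable_ite_le _ _)]
  simp only [integral_ite_le (hρ.1 _).1 (hρ.1 _).2, greedyValue]
  simp

theorem intervalIntegrable_apply_theta (f : (∀ j, X j) → ℝ) {ρ : Estimate X}
    (hρ : ρ ∈ Omega X) :
    IntervalIntegrable (fun t => f (theta ρ t)) MeasureTheory.volume 0 1 := by
  obtain ⟨σ, hσ⟩ := exists_isGreedyOrder hρ
  simp only [apply_theta_eq f hρ hσ]
  exact intervalIntegrable_const_add_sum_ite ρ σ _ _

/-- The extension is the mean of `f` over the roundings at a uniformly random threshold. -/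
theorem extension_eq_integral (f : (∀ j, X j) → ℝ) {ρ : Estimate X} (hρ : ρ ∈ Omega X) :
    extension f ρ = ∫ t in (0 : ℝ)..1, f (theta ρ t) := by
  obtain ⟨σ, hσ⟩ := exists_isGreedyOrder hρ
  rw [← greedyValue_eq_extension f hρ hσ, greedyValue_eq_integral f σ hρ]
  simp only [apply_theta_eq f hρ hσ]

/-! ### Greedy subgradients and convexity -/

/-- Along a maximal chain `y_0 < y_1 < …`, the increments of a submodular `f` at the steps that
stay below `x` are at most those of `f (x ⊓ y_s)`, and the latter telescope to `f x - f ⊥`. -/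
theorem greedy_sum_le_apply {f : (∀ j, X j) → ℝ} (hf : IsSubmodular f) {σ : Enumeration X}
    (hσ : ∀ (j : ι) (x y : {x : X j // ⊥ < x}), x < y → σ.symm ⟨j, x⟩ < σ.symm ⟨j, y⟩)
    (x : ∀ j, X j) :
    f (fun _ => ⊥) + ∑ s : Fin (Fintype.card (LevelIndex X)),
      (if (σ s).2.1 ≤ x (σ s).1 then
        f (greedyPoint σ (s.val + 1)) - f (greedyPoint σ s.val) else 0) ≤ f x := by
  have hbot : x ⊓ greedyPoint σ 0 = fun _ => ⊥ := by
    funext j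
    simp [greedyPoint]
  have htop : x ⊓ greedyPoint σ (Fintype.card (LevelIndex X)) = x := by
    refine inf_eq_left.2 fun j => ?_
    rcases (bot_le (a := x j)).eq_or_lt with h | h
    · simp [← h]
    · exact (le_greedyPoint_iff hσ le_rfl j ⟨x j, h⟩).2 (Fin.is_lt _)
  have htel : f x = f (fun _ => ⊥) + ∑ s : Fin (Fintype.card (LevelIndex X)),
      (f (x ⊓ greedyPoint σ (s.val + 1)) - f (x ⊓ greedyPoint σ s.val)) := by
    rw [Fin.sum_univ_eq_sum_range
      (fun s => f (x ⊓ greedyPoint σ (s + 1)) - f (x ⊓ greedyPoint σ s)),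
      Finset.sum_range_sub (fun s => f (x ⊓ greedyPoint σ s)), htop, hbot]
    ring
  rw [htel]
  gcongr with s _
  have hstep : greedyPoint σ (s.val + 1) =
      Function.update (greedyPoint σ s.val) (σ s).1 (σ s).2.1 := by
    rw [greedyPoint, dif_pos s.2]
  have hlt : greedyPoint σ s.val (σ s).1 < (σ s).2.1 := by
    rw [← not_le, le_greedyPoint_iff hσ s.2.le (σ s).1 (σ s).2]
    simp
  split_ifs with h
  · have h1 : x ⊓ greedyPoint σ (s.val + 1) ⊔ greedyPoint σ s.val
        = greedyPoint σ (s.val + 1) := by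
      funext j
      rw [hstep]
      by_cases hj : j = (σ s).1
      · subst hj
        simp [h, hlt.le]
      · simp [Function.update_of_ne hj]
    have h2 : x ⊓ greedyPoint σ (s.val + 1) ⊓ greedyPoint σ s.val
        = x ⊓ greedyPoint σ s.val := by
      funext j
      rw [hstep]
      by_cases hj : j = (σ s).1
      · subst hj
        simp [inf_assoc, hlt.le]
      · simp [Function.update_of_ne hj]
    have := hf (x ⊓ greedyPoint σ (s.val + 1)) (greedyPoint σ s.val)
    rw [h1, h2] at this
    linarith
  · -- the step goes from below `x j` past it, so the meet with `x` does not change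
    have hx : x (σ s).1 ≤ greedyPoint σ s.val (σ s).1 := by
      rcases (bot_le (a := x (σ s).1)).eq_or_lt with h0 | h0
      · simp [← h0]
      · rw [le_greedyPoint_iff hσ s.2.le (σ s).1 ⟨_, h0⟩]
        have h3 : σ.symm ⟨(σ s).1, ⟨x (σ s).1, h0⟩⟩ < σ.symm ⟨(σ s).1, (σ s).2⟩ :=
          hσ _ _ _ (not_le.1 h)
        simpa using h3
    have h1 : x ⊓ greedyPoint σ (s.val + 1) = x ⊓ greedyPoint σ s.val := by
      funext j
      rw [hstep]
      by_cases hj : j = (σ s).1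
      · subst hj
        simp [hx, hx.trans hlt.le]
      · simp [Function.update_of_ne hj]
    rw [h1, sub_self]

/-- For a submodular `f`, the extension is the maximum of the linear functions that arise from
the orders which respect the chains. -/
theorem greedyValue_le_extension {f : (∀ j, X j) → ℝ} (hf : IsSubmodular f) {σ : Enumeration X}
    (hσ : ∀ (j : ι) (x y : {x : X j // ⊥ < x}), x < y → σ.symm ⟨j, x⟩ < σ.symm ⟨j, y⟩)
    {ρ : Estimate X} (hρ : ρ ∈ Omega X) : greedyValue f σ ρ ≤ extension f ρ := by
  rw [greedyValue_eq_integral f σ hρ, extension_eq_integral f hρ]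
  refine intervalIntegral.integral_mono_on zero_le_one
    (intervalIntegrable_const_add_sum_ite ρ σ _ _) (intervalIntegrable_apply_theta f hρ)
    fun t _ => ?_
  simp only [← le_theta_iff hρ t _ (σ _).2]
  exact greedy_sum_le_apply hf hσ _

theorem greedyValue_eq_inner (f : (∀ j, X j) → ℝ) (σ : Enumeration X) (ρ : Estimate X) :
    greedyValue f σ ρ = f (fun _ => ⊥) + inner ℝ (greedySubgradient f σ) ρ := by
  rw [greedyValue, PiLp.inner_apply, ← σ.sum_comp]
  simp [greedySubgradient]

/-- The greedy vector at `ν` is a subgradient of the extension. -/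
theorem extension_add_inner_le {f : (∀ j, X j) → ℝ} (hf : IsSubmodular f) {ν π : Estimate X}
    (hν : ν ∈ Omega X) (hπ : π ∈ Omega X) {σ : Enumeration X} (hσ : IsGreedyOrder ν σ) :
    extension f ν + inner ℝ (greedySubgradient f σ) (π - ν) ≤ extension f π := by
  have h := greedyValue_le_extension hf hσ.2 hπ
  rw [← greedyValue_eq_extension f hν hσ, greedyValue_eq_inner, inner_sub_right]
  rw [greedyValue_eq_inner] at h
  linarith

theorem convexOn_of_exists_subgradient {E : Type*} [NormedAddCommGroup E]
    [InnerProductSpace ℝ E] {s : Set E} (hs : Convex ℝ s) {F : E → ℝ}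
    (h : ∀ x ∈ s, ∃ g : E, ∀ y ∈ s, F x + inner ℝ g (y - x) ≤ F y) : ConvexOn ℝ s F := by
  refine ⟨hs, fun x hx y hy a b ha hb hab => ?_⟩
  obtain ⟨g, hg⟩ := h _ (hs hx hy ha hb hab)
  have h1 := mul_le_mul_of_nonneg_left (hg x hx) ha
  have h2 := mul_le_mul_of_nonneg_left (hg y hy) hb
  simp only [inner_sub_right, inner_add_right, inner_smul_right] at h1 h2
  obtain rfl : b = 1 - a := by linarith
  simp only [smul_eq_mul]
  linarith

theorem convexOn_extension {f : (∀ j, X j) → ℝ} (hf : IsSubmodular f) :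
    ConvexOn ℝ (Omega X) (extension f) := by
  refine convexOn_of_exists_subgradient convex_omega fun ν hν => ?_
  obtain ⟨σ, hσ⟩ := exists_isGreedyOrder hν
  exact ⟨_, fun π hπ => extension_add_inner_le hf hν hπ hσ⟩

omit [Fintype ι] [DecidableEq ι] [∀ j, OrderBot (X j)] [∀ j, Fintype (X j)] in
theorem isSubmodular_totalCost {V : Type*} [Fintype V] {J : V → (∀ j, X j) → ℝ}
    (hJ : ∀ i, IsSubmodular (J i)) : IsSubmodular (totalCost J) := by
  intro x y
  simp only [totalCost, ← Finset.sum_add_distrib]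
  exact Finset.sum_le_sum fun i _ => hJ i x y

theorem extension_totalCost {V : Type*} [Fintype V] (J : V → (∀ j, X j) → ℝ) {ρ : Estimate X}
    (hρ : ρ ∈ Omega X) : extension (totalCost J) ρ = ∑ i, extension (J i) ρ := by
  simp only [extension_eq_integral _ hρ, totalCost]
  exact intervalIntegral.integral_finsetSum fun i _ => intervalIntegrable_apply_theta _ hρ

/-! ### Exactness of the relaxation -/

theorem extension_vertex (f : (∀ j, X j) → ℝ) (x : ∀ j, X j) : extension f (vertex x) = f x := by
  rw [extension_eq_integral f (vertex_mem_omega x),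
    intervalIntegral.integral_of_le zero_le_one,
    MeasureTheory.setIntegral_congr_fun (g := fun _ => f x) measurableSet_Ioc
      fun t ht => by simp only [theta_vertex x ht]]
  simp

theorem le_extension {f : (∀ j, X j) → ℝ} {m : ℝ} (hm : ∀ x, m ≤ f x) {ρ : Estimate X}
    (hρ : ρ ∈ Omega X) : m ≤ extension f ρ := by
  rw [extension_eq_integral f hρ]
  simpa using intervalIntegral.integral_mono_on zero_le_one (by simp)
    (intervalIntegrable_apply_theta f hρ) (fun t _ => hm (theta ρ t)) (f := fun _ => m)

/-- The extension attains a lower bound `m` of `f` exactly when all roundings have value `m`. The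
threshold `0` is excluded when some entry vanishes: only there can a rounding occur on a null set
of thresholds. -/
theorem extension_eq_iff {f : (∀ j, X j) → ℝ} {m : ℝ} (hm : ∀ x, m ≤ f x) {ρ : Estimate X}
    (hρ : ρ ∈ Omega X) :
    extension f ρ = m ↔ ∀ t ∈ Set.Icc (0 : ℝ) 1, (0 < t ∨ ∀ q, ρ q ≠ t) → f (theta ρ t) = m := by
  rw [extension_eq_integral f hρ]
  constructor
  · intro h
    have hint := intervalIntegrable_apply_theta f hρ
    have h0 : ∫ t in (0 : ℝ)..1, (f (theta ρ t) - m) = 0 := by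
      rw [intervalIntegral.integral_sub hint (by simp), h]
      simp
    have hae : ∀ᵐ t ∂MeasureTheory.volume.restrict (Set.Ioc (0 : ℝ) 1),
        f (theta ρ t) = m := by
      have := (intervalIntegral.integral_eq_zero_iff_of_le_of_nonneg_ae zero_le_one
        (MeasureTheory.ae_of_all _ fun t => sub_nonneg.2 (hm _)) (hint.sub (by simp))).1 h0
      filter_upwards [this] with t ht
      exact sub_eq_zero.1 ht
    -- a rounding that also occurs on a nondegenerate interval of thresholds is optimal
    have key : ∀ t a b : ℝ, 0 ≤ a → a < b → b ≤ 1 →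
        (∀ s ∈ Set.Ioo a b, theta ρ s = theta ρ t) → f (theta ρ t) = m := by
      intro t a b ha hab hb hs
      by_contra hne
      have h1 := (MeasureTheory.ae_restrict_iff' measurableSet_Ioc).1 hae
      have h2 : MeasureTheory.volume (Set.Ioo a b) = 0 := by
        refine MeasureTheory.measure_mono_null (fun s hs' => ?_) h1
        simp only [Set.mem_compl_iff, Set.mem_ofPred_eq]
        intro h3
        exact hne (hs s hs' ▸ h3 ⟨ha.trans_lt hs'.1, hs'.2.le.trans hb⟩)
      rw [Real.volume_Ioo, ENNReal.ofReal_eq_zero] at h2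
      linarith
    intro t ht htq
    rcases ht.1.eq_or_lt with h1 | h1
    · subst h1
      have hpos : ∀ q, 0 < ρ q := fun q =>
        lt_of_le_of_ne (hρ.1 q).1 fun h => (htq.resolve_left (lt_irrefl _)) q h.symm
      have hev : ∀ᶠ s in 𝓝[>] (0 : ℝ), ∀ q, s < ρ q :=
        eventually_all.2 fun q => eventually_nhdsWithin_of_eventually_nhds
          (eventually_lt_nhds (hpos q))
      obtain ⟨b, hb, hb'⟩ := (mem_nhdsGT_iff_exists_Ioo_subset' (zero_lt_one)).1 hev
      refine key 0 0 (min b 1) le_rfl (lt_min hb zero_lt_one) (min_le_right _ _) fun s hs => ?_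
      refine theta_congr fun q => ⟨fun _ => (hpos q).le, fun _ => ?_⟩
      exact (hb' ⟨hs.1, hs.2.trans_le (min_le_left _ _)⟩ q).le
    · have hev : ∀ᶠ s in 𝓝[<] t, ∀ q, ρ q < t → ρ q < s :=
        eventually_all.2 fun q => eventually_nhdsWithin_of_eventually_nhds <| by
          by_cases hq : ρ q < t
          · exact (eventually_gt_nhds hq).mono fun s hs _ => hs
          · exact Eventually.of_forall fun s h => absurd h hq
      obtain ⟨a, ha, ha'⟩ := (mem_nhdsLT_iff_exists_Ioo_subset' h1).1 hev
      refine key t (max a 0) t (le_max_right _ _) (max_lt ha h1) ht.2 fun s hs => ?_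
      refine theta_congr fun q => ⟨fun hsq => ?_, fun htq => hs.2.le.trans htq⟩
      by_contra hq
      exact absurd hsq (not_le.2 (ha' ⟨(le_max_left _ _).trans_lt hs.1, hs.2⟩ q (not_le.1 hq)))
  · intro h
    rw [intervalIntegral.integral_of_le zero_le_one,
      MeasureTheory.setIntegral_congr_fun (g := fun _ => m) measurableSet_Ioc
        fun t ht => h t ⟨ht.1.le, ht.2⟩ (Or.inl ht.1)]
    simp

omit [DecidableEq ι] in
theorem exists_forall_apply_le (f : (∀ j, X j) → ℝ) : ∃ x, ∀ y, f x ≤ f y := by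
  have : Nonempty (∀ j, X j) := ⟨fun _ => ⊥⟩
  exact Finite.exists_min f

/-- The relaxed minimizers are the vectors all of whose roundings are minimizers. -/
theorem isMinOn_extension_iff (f : (∀ j, X j) → ℝ) {ρ : Estimate X} (hρ : ρ ∈ Omega X) :
    IsMinOn (extension f) (Omega X) ρ ↔ ∀ t ∈ Set.Icc (0 : ℝ) 1, (0 < t ∨ ∀ q, ρ q ≠ t) →
      ∀ x, f (theta ρ t) ≤ f x := by
  obtain ⟨x₀, hx₀⟩ := exists_forall_apply_le f
  have h1 : IsMinOn (extension f) (Omega X) ρ ↔ extension f ρ = f x₀ := by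
    constructor
    · intro h
      refine le_antisymm ?_ (le_extension hx₀ hρ)
      simpa [extension_vertex] using isMinOn_iff.1 h _ (vertex_mem_omega x₀)
    · intro h
      exact isMinOn_iff.2 fun π hπ => h ▸ le_extension hx₀ hπ
  rw [h1, extension_eq_iff hx₀ hρ]
  refine forall₃_congr fun t _ _ => ⟨fun h x => h ▸ hx₀ x, fun h => le_antisymm (h x₀) (hx₀ _)⟩

theorem exists_isLeast_range_and_image (f : (∀ j, X j) → ℝ) :
    ∃ m, IsLeast (Set.range f) m ∧ IsLeast (extension f '' Omega X) m := by
  obtain ⟨x₀, hx₀⟩ := exists_forall_apply_le f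
  refine ⟨f x₀, ⟨⟨x₀, rfl⟩, ?_⟩, ⟨⟨vertex x₀, vertex_mem_omega x₀, extension_vertex f x₀⟩, ?_⟩⟩
  · rintro _ ⟨x, rfl⟩
    exact hx₀ x
  · rintro _ ⟨ρ, hρ, rfl⟩
    exact le_extension hx₀ hρ

omit [DecidableEq ι] in
theorem eventually_theta_eq {α : Type*} {l : Filter α} {u : α → Estimate X} {ρ : Estimate X}
    (hu : Tendsto u l (𝓝 ρ)) {t : ℝ} (ht : ∀ q, ρ q ≠ t) :
    ∀ᶠ a in l, theta (u a) t = theta ρ t := by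
  have h : ∀ᶠ a in l, ∀ q, t ≤ u a q ↔ t ≤ ρ q := by
    refine eventually_all.2 fun q => ?_
    have hq : Tendsto (fun a => u a q) l (𝓝 (ρ q)) :=
      ((by fun_prop : Continuous fun π : Estimate X => π q).tendsto ρ).comp hu
    rcases (ht q).lt_or_gt with h | h
    · filter_upwards [hq.eventually_lt_const h] with a ha
      exact iff_of_false (not_le.2 ha) (not_le.2 h)
    · filter_upwards [hq.eventually_const_lt h] with a ha
      exact iff_of_true ha.le h.le
  exact h.mono fun a ha => theta_congr ha

end Relaxation

/-! ### Weighted averaging on a strongly connected network -/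

section Averaging

variable {V : Type*} [Fintype V] {E : Type*} [NormedAddCommGroup E] [InnerProductSpace ℝ E]

/-- The variance identity `‖∑ a_w z_w - x‖² = ∑ a_w ‖z_w - x‖² - ½ ∑∑ a_w a_v ‖z_w - z_v‖²`. -/
theorem norm_sum_smul_sub_sq {a : V → ℝ} (ha : ∑ w, a w = 1) (z : V → E) (x : E) :
    ‖∑ w, a w • z w - x‖ ^ 2 = ∑ w, a w * ‖z w - x‖ ^ 2 -
      (∑ w, ∑ v, a w * a v * ‖z w - z v‖ ^ 2) / 2 := by
  have h1 : ∑ w, a w • z w - x = ∑ w, a w • (z w - x) := by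
    simp [smul_sub, Finset.sum_sub_distrib, ← Finset.sum_smul, ha]
  have h2 : ∀ w v, a w * a v * ‖z w - z v‖ ^ 2 = a v * (a w * ‖z w - x‖ ^ 2)
      + a w * (a v * ‖z v - x‖ ^ 2) - 2 * (a w * (a v * inner ℝ (z w - x) (z v - x))) := by
    intro w v
    rw [← sub_sub_sub_cancel_right (z w) (z v) x, norm_sub_sq_real]
    ring
  have h3 : ∑ w, ∑ v, a v * (a w * ‖z w - x‖ ^ 2) = ∑ w, a w * ‖z w - x‖ ^ 2 := by
    simp [← Finset.sum_mul, ha]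
  have h4 : ∑ w, ∑ v, a w * (a v * ‖z v - x‖ ^ 2) = ∑ w, a w * ‖z w - x‖ ^ 2 := by
    simp [← Finset.mul_sum, ← Finset.sum_mul, ha]
  have h5 : ∑ w, ∑ v, a w * (a v * inner ℝ (z w - x) (z v - x)) =
      ‖∑ w, a w • (z w - x)‖ ^ 2 := by
    rw [← real_inner_self_eq_norm_sq, sum_inner]
    simp only [inner_sum, real_inner_smul_left, real_inner_smul_right]
    exact Finset.sum_congr rfl fun w _ => Finset.sum_congr rfl fun v _ => by ring
  have h6 : ∑ w, ∑ v, a w * a v * ‖z w - z v‖ ^ 2 =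
      2 * ∑ w, a w * ‖z w - x‖ ^ 2 - 2 * ‖∑ w, a w • (z w - x)‖ ^ 2 := by
    rw [← h5]
    simp only [h2, Finset.sum_sub_distrib, Finset.sum_add_distrib, h3, h4, Finset.mul_sum]
    simp only [← Finset.mul_sum]
    ring
  rw [h6, h1]
  ring

/-- The loss of total variance in one round of averaging the estimates `z` with the weights `c`,
times two: a weighted sum of the squared distances between the estimates that some agent mixes. -/
def disagreement (c : Matrix V V ℝ) (z : V → E) : ℝ :=
  ∑ i, ∑ w, ∑ v, c i w * c i v * ‖z w - z v‖ ^ 2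

theorem sum_norm_average_sub_sq [DecidableEq V] {c : Matrix V V ℝ} (hc : c ∈ doublyStochastic ℝ V)
    (z : V → E) (x : E) :
    ∑ i, ‖∑ w, c i w • z w - x‖ ^ 2 = ∑ i, ‖z i - x‖ ^ 2 - disagreement c z / 2 := by
  obtain ⟨-, hrow, hcol⟩ := mem_doublyStochastic_iff_sum.1 hc
  simp only [norm_sum_smul_sub_sq (hrow _), Finset.sum_sub_distrib, disagreement, Finset.sum_div]
  rw [Finset.sum_comm]
  simp [← Finset.sum_mul, hcol]

omit [InnerProductSpace ℝ E] in
theorem mul_norm_sub_sq_le_disagreement {c : Matrix V V ℝ} (hc : ∀ i j, 0 ≤ c i j) (z : V → E)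
    (i w v : V) : c i w * c i v * ‖z w - z v‖ ^ 2 ≤ disagreement c z := by
  have hnn : ∀ i w v, 0 ≤ c i w * c i v * ‖z w - z v‖ ^ 2 := fun i w v =>
    mul_nonneg (mul_nonneg (hc _ _) (hc _ _)) (sq_nonneg _)
  calc c i w * c i v * ‖z w - z v‖ ^ 2 ≤ ∑ v, c i w * c i v * ‖z w - z v‖ ^ 2 :=
        Finset.single_le_sum (fun v _ => hnn i w v) (Finset.mem_univ v)
    _ ≤ ∑ w, ∑ v, c i w * c i v * ‖z w - z v‖ ^ 2 :=
        Finset.single_le_sum (f := fun w => ∑ v, c i w * c i v * ‖z w - z v‖ ^ 2)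
          (fun w _ => Finset.sum_nonneg fun v _ => hnn i w v) (Finset.mem_univ w)
    _ ≤ disagreement c z :=
        Finset.single_le_sum (f := fun i => ∑ w, ∑ v, c i w * c i v * ‖z w - z v‖ ^ 2)
          (fun i _ => Finset.sum_nonneg fun w _ => Finset.sum_nonneg fun v _ => hnn i w v)
          (Finset.mem_univ i)

omit [InnerProductSpace ℝ E] in
theorem disagreement_nonneg {c : Matrix V V ℝ} (hc : ∀ i j, 0 ≤ c i j) (z : V → E) :
    0 ≤ disagreement c z :=
  Finset.sum_nonneg fun _ _ => Finset.sum_nonneg fun _ _ => Finset.sum_nonneg fun _ _ =>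
    mul_nonneg (mul_nonneg (hc _ _) (hc _ _)) (sq_nonneg _)

omit [InnerProductSpace ℝ E] in
/-- On a strongly connected network the disagreement controls all distances between estimates:
an edge `(i, w)` contributes `c i i * c i w * ‖z i - z w‖²`, and edges are chained along a path. -/
theorem exists_norm_sub_sq_le_disagreement {G : Digraph V} (hG : IsStronglyConnected G)
    {c : Matrix V V ℝ} (hc : ∀ i j, 0 ≤ c i j) {η : ℝ} (hη : 0 < η) (hself : ∀ i, η ≤ c i i)
    (hedge : ∀ i j, G.Adj i j → η ≤ c i j) :
    ∃ K : ℝ, 0 < K ∧ ∀ (z : V → E) (i j : V), ‖z i - z j‖ ^ 2 ≤ K * disagreement c z := by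
  have hpair : ∀ i j, ∃ K : ℝ, 0 ≤ K ∧ ∀ z : V → E, ‖z i - z j‖ ^ 2 ≤ K * disagreement c z := by
    intro i j
    induction hG i j with
    | refl => exact ⟨0, le_rfl, fun z => by simp⟩
    | @tail v w _ hvw ih =>
      obtain ⟨K, hK0, hK⟩ := ih
      refine ⟨2 * K + 2 / (η * η), by positivity, fun z => ?_⟩
      have h1 : η * η * ‖z v - z w‖ ^ 2 ≤ disagreement c z :=
        (mul_le_mul_of_nonneg_right (mul_le_mul (hself v) (hedge v w hvw) hη.le (hc _ _))
          (sq_nonneg _)).trans (mul_norm_sub_sq_le_disagreement hc z v v w)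
      have h2 : ‖z v - z w‖ ^ 2 ≤ disagreement c z / (η * η) := by
        rw [le_div_iff₀ (by positivity)]
        linarith
      have h3 : ‖z i - z w‖ ^ 2 ≤ 2 * ‖z i - z v‖ ^ 2 + 2 * ‖z v - z w‖ ^ 2 := by
        have h4 := norm_sub_le_norm_sub_add_norm_sub (z i) (z v) (z w)
        nlinarith [norm_nonneg (z i - z w), sq_nonneg (‖z i - z v‖ - ‖z v - z w‖)]
      calc ‖z i - z w‖ ^ 2 ≤ 2 * (K * disagreement c z) + 2 * (disagreement c z / (η * η)) := by
            linarith [hK z]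
        _ = _ := by ring
  choose K hK0 hK using hpair
  have hS : 0 ≤ ∑ i, ∑ j, K i j := Finset.sum_nonneg fun i _ => Finset.sum_nonneg fun j _ => hK0 i j
  refine ⟨1 + ∑ i, ∑ j, K i j, by linarith, fun z i j => (hK i j z).trans ?_⟩
  refine mul_le_mul_of_nonneg_right ?_ (disagreement_nonneg hc z)
  have h1 : K i j ≤ ∑ j, K i j := Finset.single_le_sum (fun j _ => hK0 i j) (Finset.mem_univ j)
  have h2 : ∑ j, K i j ≤ ∑ i, ∑ j, K i j :=
    Finset.single_le_sum (f := fun i => ∑ j, K i j)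
      (fun i _ => Finset.sum_nonneg fun j _ => hK0 i j) (Finset.mem_univ i)
  linarith

end Averaging

/-! ### Convergence of the distributed projected subgradient method -/

section Convergence

/-- A deterministic version of the Robbins–Siegmund lemma. -/
theorem tendsto_and_summable_of_le_sub_add {a b e : ℕ → ℝ} (ha : ∀ k, 0 ≤ a k)
    (hb : ∀ k, 0 ≤ b k) (he0 : ∀ k, 0 ≤ e k) (he : Summable e)
    (h : ∀ k, a (k + 1) ≤ a k - b k + e k) :
    (∃ l, Tendsto a atTop (𝓝 l)) ∧ Summable b := by
  have hsum : ∀ n, ∑ k ∈ Finset.range n, e k ≤ ∑' k, e k := fun n =>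
    he.sum_le_tsum _ fun k _ => he0 k
  constructor
  · have hanti : Antitone fun n => a n - ∑ k ∈ Finset.range n, e k := by
      refine antitone_nat_of_succ_le fun n => ?_
      rw [Finset.sum_range_succ]
      linarith [h n, hb n]
    have hbdd : BddBelow (Set.range fun n => a n - ∑ k ∈ Finset.range n, e k) := by
      refine ⟨-∑' k, e k, ?_⟩
      rintro _ ⟨n, rfl⟩
      have := hsum n
      have := ha n
      simp only
      linarith
    have h1 := (tendsto_atTop_ciInf hanti hbdd).add he.hasSum.tendsto_sum_nat
    exact ⟨_, by simpa using h1⟩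
  · refine summable_of_sum_range_le (c := a 0 + ∑' k, e k) hb fun n => ?_
    have h1 : ∑ k ∈ Finset.range n, b k ≤ a 0 - a n + ∑ k ∈ Finset.range n, e k := by
      induction n with
      | zero => simp
      | succ n ih =>
        rw [Finset.sum_range_succ, Finset.sum_range_succ]
        linarith [h n]
    linarith [ha n, hsum n]

variable {E : Type*} [NormedAddCommGroup E] [InnerProductSpace ℝ E]

/-- Projecting onto a convex set does not increase the distance to its points. -/
theorem IsProjection.norm_sub_sq_le {S : Set E} (hS : Convex ℝ S) {x z : E}
    (h : IsProjection S x z) {w : E} (hw : w ∈ S) : ‖z - w‖ ^ 2 ≤ ‖x - w‖ ^ 2 := by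
  have hinf : ‖x - z‖ = ⨅ w : S, ‖x - w‖ := by
    have : Nonempty S := ⟨⟨z, h.1⟩⟩
    refine le_antisymm (le_ciInf fun w => h.2 w w.2) ?_
    exact ciInf_le ⟨0, by rintro _ ⟨w, rfl⟩; exact norm_nonneg _⟩ (⟨z, h.1⟩ : S)
  have h1 := (norm_eq_iInf_iff_real_inner_le_zero hS h.1).1 hinf w hw
  have h2 : x - w = (x - z) - (w - z) := by abel
  rw [h2, norm_sub_sq_real (x - z), norm_sub_rev z w]
  nlinarith [sq_nonneg ‖x - z‖]

omit [InnerProductSpace ℝ E] in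
theorem IsCompact.exists_isProjection {S : Set E} (hS : IsCompact S) (hne : S.Nonempty) (x : E) :
    ∃ z, IsProjection S x z := by
  obtain ⟨z, hz, h⟩ := hS.exists_isMinOn hne (f := fun w => ‖x - w‖) (by fun_prop)
  exact ⟨z, hz, isMinOn_iff.1 h⟩

variable {V : Type*} [Fintype V] [DecidableEq V]

/-- One round of the method. The gain `disagreement / 2` of the averaging pays for evaluating
the costs at different points: `F i` is taken at the agent's own average instead of the common
point `z o`, which costs at most `2 γ L ‖ν i - z o‖`, and half the gain absorbs this up
to `O(γ²)`. -/
theorem sum_norm_sub_sq_le_of_isProjection {S : Set E} (hS : Convex ℝ S) {F : V → E → ℝ} {L : ℝ}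
    (hL : ∀ i, ∀ x ∈ S, ∀ y ∈ S, F i x - F i y ≤ L * ‖x - y‖)
    {c : Matrix V V ℝ} (hc : c ∈ doublyStochastic ℝ V) {K : ℝ} (hK : 0 < K) {z z' g : V → E}
    (hKz : ∀ i j, ‖z i - z j‖ ^ 2 ≤ K * disagreement c z) (hz : ∀ i, z i ∈ S) {γ : ℝ} (hγ : 0 < γ)
    (hg : ∀ i, ‖g i‖ ≤ L)
    (hsub : ∀ i, ∀ x ∈ S, F i (∑ w, c i w • z w) + inner ℝ (g i) (x - ∑ w, c i w • z w) ≤ F i x)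
    (hz' : ∀ i, IsProjection S (∑ w, c i w • z w - γ • g i) (z' i)) (o : V) {x : E} (hx : x ∈ S) :
    ∑ i, ‖z' i - x‖ ^ 2 ≤ ∑ i, ‖z i - x‖ ^ 2
      - (disagreement c z / 4 + 2 * γ * (∑ i, F i (z o) - ∑ i, F i x))
      + Fintype.card V * (L ^ 2 + 4 * Fintype.card V * K * L ^ 2) * γ ^ 2 := by
  obtain ⟨hc0, hrow, -⟩ := mem_doublyStochastic_iff_sum.1 hc
  have hn : (0 : ℝ) < Fintype.card V := by
    exact_mod_cast Fintype.card_pos_iff.2 ⟨o⟩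
  set n : ℝ := (Fintype.card V : ℝ)
  set Q := disagreement c z
  have hν : ∀ i, ∑ w, c i w • z w ∈ S := fun i =>
    hS.sum_mem (fun w _ => hc0 i w) (hrow i) fun w _ => hz w
  have hone : ∀ i, ‖z' i - x‖ ^ 2 ≤ ‖∑ w, c i w • z w - x‖ ^ 2 - 2 * γ * (F i (z o) - F i x)
      + Q / (4 * n) + (L ^ 2 + 4 * n * K * L ^ 2) * γ ^ 2 := by
    intro i
    have h1 := (hz' i).norm_sub_sq_le hS hx
    have h2 := hsub i x hx
    have h3 := hL i _ (hz o) _ (hν i)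
    have h4 : ‖∑ w, c i w • z w - z o‖ ^ 2 ≤ K * Q := by
      rw [norm_sum_smul_sub_sq (hrow i)]
      have h5 : ∑ w, c i w * ‖z w - z o‖ ^ 2 ≤ ∑ w, c i w * (K * Q) :=
        Finset.sum_le_sum fun w _ => mul_le_mul_of_nonneg_left (hKz w o) (hc0 i w)
      rw [← Finset.sum_mul, hrow, one_mul] at h5
      have h6 : 0 ≤ ∑ w, ∑ v, c i w * c i v * ‖z w - z v‖ ^ 2 :=
        Finset.sum_nonneg fun w _ => Finset.sum_nonneg fun v _ =>
          mul_nonneg (mul_nonneg (hc0 _ _) (hc0 _ _)) (sq_nonneg _)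
      linarith
    generalize ∑ w, c i w • z w = ν at *
    have h7 : ‖ν - γ • g i - x‖ ^ 2 =
        ‖ν - x‖ ^ 2 + 2 * γ * inner ℝ (g i) (x - ν) + γ ^ 2 * ‖g i‖ ^ 2 := by
      have : ν - γ • g i - x = (ν - x) - γ • g i := by abel
      rw [this, norm_sub_sq_real, inner_smul_right, norm_smul, mul_pow, Real.norm_eq_abs, sq_abs,
        real_inner_comm, ← neg_sub x ν, inner_neg_right, norm_neg]
      ring
    rw [norm_sub_rev] at h3
    have h8 : ‖g i‖ ^ 2 ≤ L ^ 2 := pow_le_pow_left₀ (norm_nonneg _) (hg i) 2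
    -- the inequality `2 p q ≤ p² / (4 n K) + 4 n K q²`
    have h9 : 2 * γ * (L * ‖ν - z o‖) ≤ Q / (4 * n) + 4 * n * K * L ^ 2 * γ ^ 2 := by
      have h10 : ‖ν - z o‖ ^ 2 / (4 * n * K) ≤ Q / (4 * n) := by
        rw [div_le_div_iff₀ (by positivity) (by positivity)]
        nlinarith
      have h11 : 2 * γ * (L * ‖ν - z o‖) ≤
          ‖ν - z o‖ ^ 2 / (4 * n * K) + 4 * n * K * L ^ 2 * γ ^ 2 := by
        have h12 : 0 ≤ (‖ν - z o‖ - 4 * n * K * (γ * L)) ^ 2 / (4 * n * K) := by positivity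
        have h13 : (‖ν - z o‖ - 4 * n * K * (γ * L)) ^ 2 / (4 * n * K) =
            ‖ν - z o‖ ^ 2 / (4 * n * K) + 4 * n * K * L ^ 2 * γ ^ 2
              - 2 * γ * (L * ‖ν - z o‖) := by
          field_simp
          ring
        linarith
      linarith
    have h14 := mul_le_mul_of_nonneg_left h8 (sq_nonneg γ)
    have h15 := mul_le_mul_of_nonneg_left (h2) (by positivity : 0 ≤ 2 * γ)
    have h16 := mul_le_mul_of_nonneg_left (h3) (by positivity : 0 ≤ 2 * γ)
    linarith
  have hsum := Finset.sum_le_sum fun i (_ : i ∈ Finset.univ) => hone i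
  simp only [Finset.sum_add_distrib, Finset.sum_sub_distrib, ← Finset.mul_sum,
    sum_norm_average_sub_sq hc, Finset.sum_const, Finset.card_univ, nsmul_eq_mul] at hsum
  have h17 : n * (Q / (4 * n)) = Q / 4 := by field_simp
  linarith

/-- The distributed projected subgradient method for a sum of functions with bounded
subgradients on a compact convex set converges to a common minimizer. -/
theorem exists_isMinOn_and_tendsto {S : Set E} (hS : Convex ℝ S) (hcomp : IsCompact S)
    {F : V → E → ℝ} {L : ℝ} (hL : ∀ i, ∀ x ∈ S, ∀ y ∈ S, F i x - F i y ≤ L * ‖x - y‖)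
    {G : Digraph V} (hG : IsStronglyConnected G) {c : Matrix V V ℝ} (hc : c ∈ doublyStochastic ℝ V)
    {η : ℝ} (hη : 0 < η) (hself : ∀ i, η ≤ c i i) (hedge : ∀ i j, G.Adj i j → η ≤ c i j)
    {γ : ℕ → ℝ} (hγ : ∀ k, 0 < γ k) (hγ1 : ¬ Summable γ) (hγ2 : Summable fun k => γ k ^ 2)
    {z g : ℕ → V → E} (hz : ∀ k i, z k i ∈ S) (hg : ∀ k i, ‖g k i‖ ≤ L)
    (hsub : ∀ k i, ∀ x ∈ S,
      F i (∑ w, c i w • z k w) + inner ℝ (g k i) (x - ∑ w, c i w • z k w) ≤ F i x)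
    (hstep : ∀ k i, IsProjection S (∑ w, c i w • z k w - γ k • g k i) (z (k + 1) i)) (o : V) :
    ∃ x ∈ S, IsMinOn (fun x => ∑ i, F i x) S x ∧ ∀ i, Tendsto (fun k => z k i) atTop (𝓝 x) := by
  have hc0 := (mem_doublyStochastic_iff_sum.1 hc).1
  obtain ⟨K, hK, hKz⟩ := exists_norm_sub_sq_le_disagreement (E := E) hG hc0 hη hself hedge
  have hcont : ContinuousOn (fun x => ∑ i, F i x) S := by
    refine continuousOn_finsetSum _ fun i _ => ?_
    refine (LipschitzOnWith.of_le_add_mul' L fun x hx y hy => ?_).continuousOn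
    rw [dist_eq_norm]
    linarith [hL i x hx y hy]
  obtain ⟨y, hy, hymin⟩ := hcomp.exists_isMinOn ⟨_, hz 0 o⟩ hcont
  have hymin' := isMinOn_iff.1 hymin
  have hrs : ∀ x ∈ S, IsMinOn (fun x => ∑ i, F i x) S x →
      (∃ l, Tendsto (fun k => ∑ i, ‖z k i - x‖ ^ 2) atTop (𝓝 l)) ∧
      Summable fun k => disagreement c (z k) / 4
        + 2 * γ k * (∑ i, F i (z k o) - ∑ i, F i x) := by
    intro x hx hmin
    refine tendsto_and_summable_of_le_sub_add
      (e := fun k => Fintype.card V * (L ^ 2 + 4 * Fintype.card V * K * L ^ 2) * γ k ^ 2)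
      (fun k => by positivity) (fun k => ?_) (fun k => by positivity) (hγ2.mul_left _)
      (fun k => sum_norm_sub_sq_le_of_isProjection hS hL hc hK (hKz _) (hz k) (hγ k) (hg k)
        (hsub k) (hstep k) o hx)
    have h1 := disagreement_nonneg hc0 (z k)
    have h2 : ∑ i, F i x ≤ ∑ i, F i (z k o) := isMinOn_iff.1 hmin _ (hz k o)
    have h3 := mul_nonneg (hγ k).le (sub_nonneg.2 h2)
    linarith
  have hgap : ∀ k, 0 ≤ γ k * (∑ i, F i (z k o) - ∑ i, F i y) := fun k =>
    mul_nonneg (hγ k).le (sub_nonneg.2 (hymin' _ (hz k o)))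
  have hsumm := (hrs y hy hymin).2
  have hQ : Tendsto (fun k => disagreement c (z k)) atTop (𝓝 0) := by
    have h1 := (hsumm.tendsto_atTop_zero).const_mul 4
    rw [mul_zero] at h1
    exact squeeze_zero (fun k => disagreement_nonneg hc0 _) (fun k => by linarith [hgap k]) h1
  -- the values at `z k o` come arbitrarily close to the minimum, as the step sizes sum to `∞`
  have hfreq : ∀ m : ℕ, ∃ᶠ k in atTop, ∑ i, F i (z k o) - ∑ i, F i y < 1 / ((m : ℝ) + 1) := by
    intro m hcon
    refine hγ1 ?_
    have h1 : Summable fun k => γ k * (∑ i, F i (z k o) - ∑ i, F i y) := by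
      refine Summable.of_nonneg_of_le hgap (fun k => ?_) hsumm
      linarith [hgap k, disagreement_nonneg hc0 (z k)]
    refine Summable.of_norm_bounded_eventually_nat (h1.mul_left ((m : ℝ) + 1)) ?_
    filter_upwards [hcon] with k hk
    rw [Real.norm_eq_abs, abs_of_pos (hγ k)]
    have h2 : 1 / ((m : ℝ) + 1) ≤ ∑ i, F i (z k o) - ∑ i, F i y := not_lt.1 hk
    rw [div_le_iff₀ (by positivity)] at h2
    nlinarith [hγ k]
  obtain ⟨φ, hφ, hφF⟩ := extraction_forall_of_frequently hfreq
  obtain ⟨x, hx, ψ, hψ, hlim⟩ := hcomp.tendsto_subseq (x := fun m => z (φ m) o) fun m => hz _ o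
  have hval : ∑ i, F i x ≤ ∑ i, F i y := by
    have h1 : Tendsto (fun m => ∑ i, F i (z (φ (ψ m)) o)) atTop (𝓝 (∑ i, F i x)) :=
      (hcont x hx).tendsto.comp (tendsto_nhdsWithin_iff.2
        ⟨hlim, Eventually.of_forall fun m => hz _ o⟩)
    have h2 : Tendsto (fun m : ℕ => ∑ i, F i y + 1 / (((ψ m : ℕ) : ℝ) + 1)) atTop
        (𝓝 (∑ i, F i y + 0)) :=
      (tendsto_one_div_add_atTop_nhds_zero_nat.comp hψ.tendsto_atTop).const_add _
    rw [add_zero] at h2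
    exact le_of_tendsto_of_tendsto' h1 h2 fun m => by linarith [hφF (ψ m)]
  have hxmin : IsMinOn (fun x => ∑ i, F i x) S x :=
    isMinOn_iff.2 fun w hw => hval.trans (hymin' w hw)
  obtain ⟨l, hl⟩ := (hrs x hx hxmin).1
  have hφψ : Tendsto (fun m => φ (ψ m)) atTop atTop := hφ.tendsto_atTop.comp hψ.tendsto_atTop
  have hsubseq : Tendsto (fun m => ∑ i, ‖z (φ (ψ m)) i - x‖ ^ 2) atTop (𝓝 0) := by
    have h1 : ∀ i, Tendsto (fun m => ‖z (φ (ψ m)) i - x‖ ^ 2) atTop (𝓝 0) := by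
      intro i
      have h2 : Tendsto (fun m => ‖z (φ (ψ m)) i - z (φ (ψ m)) o‖ ^ 2) atTop (𝓝 0) := by
        have h3 := (hQ.comp hφψ).const_mul K
        rw [mul_zero] at h3
        exact squeeze_zero (fun m => sq_nonneg _) (fun m => hKz _ i o) h3
      have h4 : Tendsto (fun m => ‖z (φ (ψ m)) o - x‖ ^ 2) atTop (𝓝 0) := by
        simpa using (tendsto_iff_norm_sub_tendsto_zero.1 hlim).pow 2
      have h5 := (h2.const_mul 2).add (h4.const_mul 2)
      rw [mul_zero, add_zero] at h5
      refine squeeze_zero (fun m => sq_nonneg _) (fun m => ?_) h5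
      have h6 := norm_sub_le_norm_sub_add_norm_sub (z (φ (ψ m)) i) (z (φ (ψ m)) o) x
      nlinarith [norm_nonneg (z (φ (ψ m)) i - x),
        sq_nonneg (‖z (φ (ψ m)) i - z (φ (ψ m)) o‖ - ‖z (φ (ψ m)) o - x‖)]
    simpa using tendsto_finsetSum Finset.univ fun i _ => h1 i
  obtain rfl : l = 0 := tendsto_nhds_unique (hl.comp hφψ) hsubseq
  refine ⟨x, hx, hxmin, fun i => tendsto_iff_norm_sub_tendsto_zero.2 ?_⟩
  have h1 : Tendsto (fun k => ‖z k i - x‖ ^ 2) atTop (𝓝 0) :=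
    squeeze_zero (fun k => sq_nonneg _) (fun k => Finset.single_le_sum
      (f := fun i => ‖z k i - x‖ ^ 2) (fun i _ => sq_nonneg _) (Finset.mem_univ i)) hl
  simpa using h1.sqrt

end Convergence

/-! ### The distributed method for the relaxed problem -/

section Method

variable {V : Type*} [Fintype V] {ι : Type*} [Fintype ι] [DecidableEq ι] {X : ι → Type*}
  [∀ j, LinearOrder (X j)] [∀ j, OrderBot (X j)] [∀ j, Fintype (X j)]

theorem sum_closedNeighborhood {E : Type*} [AddCommGroup E] [Module ℝ E] {G : Digraph V}
    {c : Matrix V V ℝ} (hsupp : ∀ i j, j ∉ closedNeighborhood G i → c i j = 0) (z : V → E) (i : V) :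
    ∑ w : closedNeighborhood G i, c i w • z w = ∑ w, c i w • z w := by
  rw [Finset.sum_coe_sort (closedNeighborhood G i) fun w => c i w • z w]
  exact Finset.sum_subset (Finset.subset_univ _) fun w _ hw => by rw [hsupp i w hw, zero_smul]

theorem exists_norm_greedySubgradient_le (J : V → (∀ j, X j) → ℝ) :
    ∃ L : ℝ, ∀ i (σ : Enumeration X), ‖greedySubgradient (J i) σ‖ ≤ L := by
  obtain ⟨L, hL⟩ := Set.finite_range
    (fun p : V × Enumeration X => ‖greedySubgradient (J p.1) p.2‖) |>.bddAbove
  exact ⟨L, fun i σ => hL ⟨(i, σ), rfl⟩⟩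

/-- Bounded greedy subgradients make the extension Lipschitz on `Omega X`. -/
theorem extension_sub_le {f : (∀ j, X j) → ℝ} (hf : IsSubmodular f) {L : ℝ}
    (hL : ∀ σ : Enumeration X, ‖greedySubgradient f σ‖ ≤ L) {ν π : Estimate X}
    (hν : ν ∈ Omega X) (hπ : π ∈ Omega X) : extension f ν - extension f π ≤ L * ‖ν - π‖ := by
  obtain ⟨σ, hσ⟩ := exists_isGreedyOrder hν
  have h1 := extension_add_inner_le hf hν hπ hσ
  have h2 := real_inner_le_norm (greedySubgradient f σ) (ν - π)
  have h3 := mul_le_mul_of_nonneg_right (hL σ) (norm_nonneg (ν - π))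
  rw [← neg_sub ν π, inner_neg_right] at h1
  linarith

variable [DecidableEq V]

omit [Fintype ι] [DecidableEq ι] [∀ j, Fintype (X j)] in
theorem average_mem_omega {G : Digraph V} {c : Matrix V V ℝ} (hc : c ∈ doublyStochastic ℝ V)
    (hsupp : ∀ i j, j ∉ closedNeighborhood G i → c i j = 0) {z : V → Estimate X}
    (hz : ∀ i, z i ∈ Omega X) (i : V) :
    ∑ w : closedNeighborhood G i, c i w • z w ∈ Omega X := by
  obtain ⟨hc0, hrow, -⟩ := mem_doublyStochastic_iff_sum.1 hc
  rw [sum_closedNeighborhood hsupp]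
  exact convex_omega.sum_mem (fun w _ => hc0 i w) (hrow i) fun w _ => hz w

/-- The averages stay in the compact set `Omega X`, so greedy orders and projections exist at
every step. -/
theorem exists_isRun {G : Digraph V} {c : Matrix V V ℝ} (hc : c ∈ doublyStochastic ℝ V)
    (hsupp : ∀ i j, j ∉ closedNeighborhood G i → c i j = 0) (J : V → (∀ j, X j) → ℝ) (γ : ℕ → ℝ)
    {ρ₀ : V → Estimate X} (hρ₀ : ∀ i, ρ₀ i ∈ Omega X) :
    ∃ ρ : ℕ → V → Estimate X, IsRun G c J γ ρ ∧ ρ 0 = ρ₀ := by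
  have hnext : ∀ (k : ℕ) (z : {z : V → Estimate X // ∀ i, z i ∈ Omega X}),
      ∃ z' : {z : V → Estimate X // ∀ i, z i ∈ Omega X},
        ∀ i, AgentUpdate (N := closedNeighborhood G i) (J i) (fun w => c i w)
          (fun w => z.1 w) (γ (k + 1)) (z'.1 i) := by
    intro k z
    have h : ∀ i, ∃ z', AgentUpdate (N := closedNeighborhood G i) (J i) (fun w => c i w)
        (fun w => z.1 w) (γ (k + 1)) z' := by
      intro i
      obtain ⟨σ, hσ⟩ := exists_isGreedyOrder (average_mem_omega hc hsupp z.2 i)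
      obtain ⟨z', hz'⟩ := (isCompact_omega (X := X)).exists_isProjection ⟨_, hρ₀ i⟩ _
      exact ⟨z', σ, hσ, hz'⟩
    choose z' hz' using h
    exact ⟨⟨z', fun i => (hz' i).choose_spec.2.1⟩, hz'⟩
  choose next hnext using hnext
  let run : ℕ → {z : V → Estimate X // ∀ i, z i ∈ Omega X} := fun k =>
    Nat.rec ⟨ρ₀, hρ₀⟩ (fun k z => next k z) k
  exact ⟨fun k => (run k).1, ⟨hρ₀, fun k i => hnext k (run k) i⟩, rfl⟩

/-- Every run converges to one common minimizer of the relaxed problem. Without agents the cost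
is `0` and any minimizer will do. -/
theorem IsRun.exists_isMinOn_and_tendsto {J : V → (∀ j, X j) → ℝ} (hJ : ∀ i, IsSubmodular (J i))
    {G : Digraph V} (hG : IsStronglyConnected G) {c : Matrix V V ℝ}
    (hc : c ∈ doublyStochastic ℝ V) (hsupp : ∀ i j, j ∉ closedNeighborhood G i → c i j = 0)
    {η : ℝ} (hη : 0 < η) (hself : ∀ i, η ≤ c i i) (hedge : ∀ i j, G.Adj i j → η ≤ c i j)
    {γ : ℕ → ℝ} (hγ : ∀ k, 0 < γ k) (hγ1 : ¬ Summable γ) (hγ2 : Summable fun k => γ k ^ 2)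
    {ρ : ℕ → V → Estimate X} (hρ : IsRun G c J γ ρ) :
    ∃ ρstar ∈ Omega X, IsMinOn (extension (totalCost J)) (Omega X) ρstar ∧
      ∀ i, Tendsto (fun k => ρ k i) atTop (𝓝 ρstar) := by
  cases isEmpty_or_nonempty V with
  | inl hV =>
    obtain ⟨-, -, ⟨π, hπ, rfl⟩, h⟩ := exists_isLeast_range_and_image (totalCost J)
    exact ⟨π, hπ, isMinOn_iff.2 fun π' hπ' => h ⟨π', hπ', rfl⟩, fun i => isEmptyElim i⟩
  | inr hV =>
    have hmem : ∀ k i, ρ k i ∈ Omega X := by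
      intro k i
      cases k with
      | zero => exact hρ.init i
      | succ k => exact (hρ.step k i).choose_spec.2.1
    choose σ hσ hproj using hρ.step
    obtain ⟨L, hL⟩ := exists_norm_greedySubgradient_le J
    have hav := fun k i => average_mem_omega hc hsupp (hmem k) i
    simp only [sum_closedNeighborhood hsupp] at hσ hproj hav
    obtain ⟨π, hπ, hmin, hlim⟩ := _root_.exists_isMinOn_and_tendsto convex_omega isCompact_omega
      (F := fun i => extension (J i))
      (fun i x hx y hy => extension_sub_le (hJ i) (hL i) hx hy) hG hc hη hself hedge
      (γ := fun k => γ (k + 1)) (fun k => hγ _)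
      (fun h => hγ1 ((summable_nat_add_iff 1).1 h)) ((summable_nat_add_iff 1).2 hγ2) hmem
      (fun k i => hL i (σ k i))
      (fun k i x hx => extension_add_inner_le (hJ i) (hav k i) hx (hσ k i)) hproj hV.some
    refine ⟨π, hπ, isMinOn_iff.2 fun π' hπ' => ?_, hlim⟩
    rw [extension_totalCost J hπ, extension_totalCost J hπ']
    exact isMinOn_iff.1 hmin π' hπ'

end Method

theorem theorem1 {V : Type*} [Fintype V] [DecidableEq V]
    {ι : Type*} [Fintype ι] [DecidableEq ι] {X : ι → Type*}
    [∀ j, LinearOrder (X j)] [∀ j, OrderBot (X j)] [∀ j, Fintype (X j)]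
    (J : V → (∀ j, X j) → ℝ) (hJ : ∀ i, IsSubmodular (J i))
    (G : Digraph V) (hG : IsStronglyConnected G)
    (c : Matrix V V ℝ) (hc : c ∈ doublyStochastic ℝ V)
    (hsupp : ∀ i j, j ∉ closedNeighborhood G i → c i j = 0)
    (η : ℝ) (hη : η ∈ Set.Ioo (0 : ℝ) 1)
    (hself : ∀ i, η ≤ c i i) (hedge : ∀ i j, G.Adj i j → η ≤ c i j) :
    -- the relaxed problem is convex, decomposes over the agents, and is equivalent to min J
    (∀ i, ConvexOn ℝ (Omega X) (extension (J i))) ∧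
    ConvexOn ℝ (Omega X) (extension (totalCost J)) ∧
    (∀ ρ ∈ Omega X, extension (totalCost J) ρ = ∑ i, extension (J i) ρ) ∧
    (∃ m, IsLeast (Set.range (totalCost J)) m ∧
      IsLeast (extension (totalCost J) '' Omega X) m) ∧
    (∀ ρ ∈ Omega X, IsMinOn (extension (totalCost J)) (Omega X) ρ ↔
      ∀ t ∈ Set.Icc (0 : ℝ) 1, (0 < t ∨ ∀ q, ρ q ≠ t) →
        ∀ x, totalCost J (theta ρ t) ≤ totalCost J x) ∧
    -- the distributed method runs from every feasible start and solves the problem exactly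
    ∀ γ : ℕ → ℝ, (∀ k, 0 < γ k) → ¬ Summable γ → Summable (fun k => γ k ^ 2) →
      (∀ ρ₀ : V → Estimate X, (∀ i, ρ₀ i ∈ Omega X) →
        ∃ ρ : ℕ → V → Estimate X, IsRun G c J γ ρ ∧ ρ 0 = ρ₀) ∧
      ∀ ρ : ℕ → V → Estimate X, IsRun G c J γ ρ →
        ∃ ρstar ∈ Omega X, IsMinOn (extension (totalCost J)) (Omega X) ρstar ∧
          (∀ i, Tendsto (fun k => ρ k i) atTop (𝓝 ρstar)) ∧
          (∀ t ∈ Set.Icc (0 : ℝ) 1, (0 < t ∨ ∀ q, ρstar q ≠ t) →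
            ∀ x, totalCost J (theta ρstar t) ≤ totalCost J x) ∧
          (∀ t ∈ Set.Icc (0 : ℝ) 1, (∀ q, ρstar q ≠ t) →
            ∀ᶠ k in atTop, ∀ i, theta (ρ k i) t = theta ρstar t ∧
              ∀ x, totalCost J (theta (ρ k i) t) ≤ totalCost J x) := by
  refine ⟨fun i => convexOn_extension (hJ i), convexOn_extension (isSubmodular_totalCost hJ),
    fun ρ hρ => extension_totalCost J hρ, exists_isLeast_range_and_image _,
    fun ρ hρ => isMinOn_extension_iff _ hρ, fun γ hγ hγ1 hγ2 =>
      ⟨fun ρ₀ hρ₀ => exists_isRun hc hsupp J γ hρ₀, fun ρ hρ => ?_⟩⟩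
  obtain ⟨π, hπ, hmin, hlim⟩ :=
    hρ.exists_isMinOn_and_tendsto hJ hG hc hsupp hη.1 hself hedge hγ hγ1 hγ2
  have hround := (isMinOn_extension_iff _ hπ).1 hmin
  refine ⟨π, hπ, hmin, hlim, hround, fun t ht htq => ?_⟩
  filter_upwards [eventually_all.2 fun i => eventually_theta_eq (hlim i) htq] with k hk i
  exact ⟨hk i, fun x => hk i ▸ hround t ht (Or.inr htq) x⟩
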